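/- For $w\in\mathbb C\setminus\{0\}$ write $[w]=w-w^{-1}$. For $n\ge 0$, $q,b,c\in\mathbb C\setminus\{0\}$ and $\mathbf x=(x_1,\dots,x_n)$, $\mathbf y=(y_1,\dots,y_n)\in\mathbb C^n$, let $M_{UU}(\mathbf x;\mathbf y;b,c)$ be the $n\times n$ matrix with entries $$M_{ij}=\frac{[b/y_j][c x_i]}{[q x_i/y_j]}-\frac{[b/y_j][c/x_i]}{[q/(x_iy_j)]}+\frac{[b y_j][c/x_i]}{[q y_j/x_i]}-\frac{[b y_j][c x_i]}{[q x_iy_j]},$$ and let $$Z^{(2)}_{UU}(\mathbf x;\mathbf y;b,c)=\frac{\prod_{i,j=1}^n[q x_i/y_j][q y_j/x_i][q x_iy_j][q/(x_iy_j)]}{\prod_{1\le i<j\le n}[x_j/x_i][y_i/y_j]\prod_{1\le i\le j\le n}[1/(x_ix_j)][y_iy_j]}\;\det M_{UU}(\mathbf x;\mathbf y;b,c).$$ Kuperberg's polynomial $A^{(2)}_{UU}(4n;t,y,z)$ is the polynomial in the three variables $t,y,z$ determined by $$A^{(2)}_{UU}(4n;t,y,z)=\frac{[q^2]^{2n}\,Z^{(2)}_{UU}(1,\dots,1;1,\dots,1;b,c)}{[q]^{n(2n+1)}\,([b/q][c/q])^n},\qquad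 t=\Big(\frac{[q^2]}{[q]}\Big)^2,\quad y=\frac{[bq]}{[b/q]},\quad z=\frac{[cq]}{[c/q]},$$ for all non-zero $q,b,c$ with $[q],[b/q],[c/q]\neq 0$, where the value of $Z^{(2)}_{UU}$ at $\mathbf x=\mathbf y=(1,\dots,1)$ is its limit through points at which the denominator of its prefactor does not vanish. Then for every $n\ge 0$ there is exactly one such polynomial over $\mathbb C$ (in particular the limit exists), and it is given by the determinant $$A^{(2)}_{UU}(4n;t,y,z)=\det_{i,j=0}^{n-1}\Bigg[\sum_{k=0}^{n-1}\bigg\{\big(t+(1+y)(1+z)\big)\binom{i+j}{i+k}\binom{i+k}{2k}t^k+\bigg((1+z)\binom{i+j}{i+k}\binom{i+k}{2k+1}+(1+y)\binom{i+j}{i+k+1}\binom{i+k+1}{2k+1}\bigg)t^{k+1}\bigg\}\Bigg].$$ -/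

import Mathlib

open Filter Topology

noncomputable section

namespace KuperbergUU

/-- The notation `[z] = z - z⁻¹`. -/
def bracket (z : ℂ) : ℂ := z - z⁻¹

/-- The matrix `M_UU(x; y; b, c)`, at crossing parameter `q`. -/
def matrixUU {n : ℕ} (q b c : ℂ) (x y : Fin n → ℂ) : Matrix (Fin n) (Fin n) ℂ :=
  Matrix.of fun i j =>
    bracket (b / y j) * bracket (c * x i) / bracket (q * x i / y j)
      - bracket (b / y j) * bracket (c / x i) / bracket (q / (x i * y j))
      + bracket (b * y j) * bracket (c / x i) / bracket (q * y j / x i)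
      - bracket (b * y j) * bracket (c * x i) / bracket (q * x i * y j)

/-- The numerator of the prefactor of `Z_UU^(2)`. -/
def numeratorUU {n : ℕ} (q : ℂ) (x y : Fin n → ℂ) : ℂ :=
  ∏ i, ∏ j, bracket (q * x i / y j) * bracket (q * y j / x i)
    * bracket (q * x i * y j) * bracket (q / (x i * y j))

/-- The denominator of the prefactor of `Z_UU^(2)`: the product over `i < j` of
`[x_j / x_i] [y_i / y_j]` times the product over `i ≤ j` of `[1 / (x_i x_j)] [y_i y_j]`. -/
def denominatorUU {n : ℕ} (x y : Fin n → ℂ) : ℂ :=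
  (∏ i, ∏ j ∈ Finset.Ioi i, bracket (x j / x i) * bracket (y i / y j))
    * ∏ i, ∏ j ∈ Finset.Ici i, bracket (1 / (x i * x j)) * bracket (y i * y j)

/-- Kuperberg's function `Z_UU^(2)(x_1, …, x_n; y_1, …, y_n; b, c)`, as a determinant. It is a
Laurent polynomial, given by this quotient wherever the denominators do not vanish. -/
def ZUU2 {n : ℕ} (q b c : ℂ) (x y : Fin n → ℂ) : ℂ :=
  numeratorUU q x y / denominatorUU x y * (matrixUU q b c x y).det

/-- `t = ([q²] / [q])²`. -/
def tParam (q : ℂ) : ℂ := (bracket (q ^ 2) / bracket q) ^ 2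

/-- `y = [b q] / [b / q]` (and, with `c` in place of `b`, the parameter `z`). -/
def boundaryParam (q b : ℂ) : ℂ := bracket (b * q) / bracket (b / q)

/-- The polynomial `P(t, y, z)` is `A_UU^(2)(4n; t, y, z)`: for all parameters `q, b, c` for which
the expressions make sense,
`P(t, y, z) = [q²]^(2n) Z_UU^(2)(1, …, 1; 1, …, 1; b, c) / ([q]^(n(2n+1)) ([b/q] [c/q])^n)` where
`t = ([q²]/[q])²`, `y = [bq]/[b/q]`, `z = [cq]/[c/q]`. Both the numerator determinant and the
denominator of `Z_UU^(2)` vanish when all the variables are `1`, so its value there is the limit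
taken through points where the denominator is non-zero. The variables `0, 1, 2` of the
polynomial are `t, y, z`. -/
def IsAUU2 (n : ℕ) (P : MvPolynomial (Fin 3) ℂ) : Prop :=
  ∀ q b c : ℂ, q ≠ 0 → b ≠ 0 → c ≠ 0 →
    bracket q ≠ 0 → bracket (b / q) ≠ 0 → bracket (c / q) ≠ 0 →
    Tendsto
      (fun p : (Fin n → ℂ) × (Fin n → ℂ) =>
        bracket (q ^ 2) ^ (2 * n) * ZUU2 q b c p.1 p.2
          / (bracket q ^ (n * (2 * n + 1)) * (bracket (b / q) * bracket (c / q)) ^ n))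
      (𝓝[{p | denominatorUU p.1 p.2 ≠ 0}] (fun _ => 1, fun _ => 1))
      (𝓝 (MvPolynomial.eval ![tParam q, boundaryParam q b, boundaryParam q c] P))

end KuperbergUU

end

/-! Put `U = ([y]/[q])²` and `V = ([x]/[q])²`. Up to factors depending on `x` alone or on `y` alone,
an entry of `M_UU` is the value at `(U, V)` of the single rational function `f = (e₀ (1 - U - V) + t
e₁ U + t e₂ V) / ((1 - U - V)² - t U V)`, with `e₀ = t + (1 + y)(1 + z)`, `e₁ = 1 + z`, `e₂ = 1 + y`
(`matrixUU_entry`). The denominator of the prefactor is, up to the same kind of factors, the product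
of the Vandermonde determinants in the `U`s and in the `V`s (`denominatorUU_eq`). What remains is a
product tending to 1 times `det f(U_i, V_j)` divided by both Vandermondes, and as all nodes tend to
0 this quotient tends to the determinant of the Taylor coefficients of `f`.

The confluent limit is made rigorous by Newton interpolation. Write `(f(u_i, v_j)) = N_u K N_vᵀ`,
where `det N_u` is the Vandermonde determinant. Clearing the denominator of `f` characterizes `K` by
a linear system whose coefficients are polynomial in the nodes (`newton_conj_interpMatrix`). At
coalesced nodes the shifts are nilpotent and the system is invertible, so `K` is continuous there
(`continuousAt_interpMatrix`). Its value there is the Taylor matrix (`interpMatrix_zero`), read off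
by expanding `f` in powers of `t U V / (1 - U - V)²`.

Uniqueness holds because the limits are taken along a nontrivial filter and the values of `(t, y,
z)` contain enough points to determine a polynomial (`eq_of_eval_eq`). -/

noncomputable section

namespace KuperbergUU

open Matrix
open scoped Kronecker

variable {n : ℕ}

/-! ### Newton bases and multiplication by the variable -/

/-- The Newton polynomial `∏ (w - u k)` over the nodes of index `k < m`. -/
def newtonFactor (u : Fin n → ℂ) (m : ℕ) (w : ℂ) : ℂ :=
  ∏ k : Fin n, if (k : ℕ) < m then w - u k else 1

/-- The values of the Newton polynomials at the nodes. -/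
def newtonMatrix (u : Fin n → ℂ) : Matrix (Fin n) (Fin n) ℂ :=
  Matrix.of fun i s => newtonFactor u s (u i)

/-- Multiplication by the variable, modulo `∏ (w - u k)`, in the Newton basis. -/
def newtonShift (u : Fin n → ℂ) : Matrix (Fin n) (Fin n) ℂ :=
  Matrix.of fun r s => (if r = s then u s else 0) + if (r : ℕ) = s + 1 then 1 else 0

/-- The matrix unit at position `(0, 0)`. -/
def cornerMatrix (n : ℕ) : Matrix (Fin n) (Fin n) ℂ :=
  Matrix.of fun i j => if (i : ℕ) = 0 ∧ (j : ℕ) = 0 then 1 else 0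

lemma newtonFactor_succ (u : Fin n → ℂ) (s : Fin n) (w : ℂ) :
    newtonFactor u (s + 1) w = newtonFactor u s w * (w - u s) := by
  have h : (w - u s) = ∏ k : Fin n, if k = s then w - u k else 1 := by simp
  rw [newtonFactor, newtonFactor, h, ← Finset.prod_mul_distrib]
  refine Finset.prod_congr rfl fun k _ => ?_
  rcases lt_trichotomy (k : ℕ) s with hk | hk | hk
  · have : k ≠ s := fun h => by simp [h] at hk
    simp [hk, this, Nat.lt_succ_of_lt hk]
  · have : k = s := Fin.ext hk
    simp [this]
  · have h1 : k ≠ s := fun h => by simp [h] at hk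
    have h2 : ¬ (k : ℕ) < s + 1 := by omega
    have h3 : ¬ (k : ℕ) < s := by omega
    simp [h1, h2, h3]

lemma newtonFactor_node_eq_zero (u : Fin n → ℂ) {m : ℕ} (i : Fin n) (h : (i : ℕ) < m) :
    newtonFactor u m (u i) = 0 :=
  Finset.prod_eq_zero (Finset.mem_univ i) (by simp [h])

/-- This is the recurrence `w N_s = N_{s+1} + u_s N_s` at the nodes. In the last column the missing
`N_n` does no harm, since it vanishes at every node. -/
lemma newtonMatrix_mul_newtonShift (u : Fin n → ℂ) :
    newtonMatrix u * newtonShift u = diagonal u * newtonMatrix u := by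
  ext i s
  rw [Matrix.mul_apply, Matrix.diagonal_mul]
  simp only [newtonMatrix, newtonShift, Matrix.of_apply, mul_add, Finset.sum_add_distrib, mul_ite,
    mul_zero, mul_one, Finset.sum_ite_eq', Finset.mem_univ, if_true]
  have key : (∑ r : Fin n, if (r : ℕ) = s + 1 then newtonFactor u r (u i) else 0)
      = newtonFactor u (s + 1) (u i) := by
    by_cases hs : (s : ℕ) + 1 < n
    · rw [Finset.sum_eq_single (⟨s + 1, hs⟩ : Fin n)]
      · simp
      · intro r _ hr
        rw [if_neg fun h => hr (Fin.ext h)]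
      · simp
    · rw [newtonFactor_node_eq_zero u i (by omega)]
      refine Finset.sum_eq_zero fun r _ => if_neg ?_
      omega
  rw [key, newtonFactor_succ]
  ring

lemma det_newtonMatrix (u : Fin n → ℂ) :
    (newtonMatrix u).det = ∏ i, ∏ j ∈ Finset.Ioi i, (u j - u i) := by
  rw [Matrix.det_of_isLowerTriangular]
  · have h : ∀ i : Fin n, newtonMatrix u i i = ∏ k ∈ Finset.Iio i, (u i - u k) := by
      intro i
      rw [newtonMatrix, Matrix.of_apply, newtonFactor, ← Finset.prod_filter]
      refine Finset.prod_congr ?_ fun _ _ => rfl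
      ext k
      simp
    rw [Finset.prod_congr rfl fun i _ => h i]
    exact Finset.prod_comm' (by simp)
  · intro i j hij
    exact newtonFactor_node_eq_zero u i hij

/-- Since `N_0 = 1`, the corner unit represents the constant function 1. -/
lemma newtonMatrix_mul_cornerMatrix_mul (u v : Fin n → ℂ) (i j : Fin n) :
    (newtonMatrix u * cornerMatrix n * (newtonMatrix v)ᵀ) i j = 1 := by
  have hn : 0 < n := i.pos
  have hc : cornerMatrix n = Matrix.single ⟨0, hn⟩ ⟨0, hn⟩ 1 := by
    ext a b
    simp [cornerMatrix, Matrix.single_apply, Fin.ext_iff, eq_comm]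
  rw [hc, Matrix.mul_assoc, Matrix.mul_apply, Finset.sum_eq_single (⟨0, hn⟩ : Fin n)]
  · have h0 : ∀ k : Fin n, ¬ k < ⟨0, hn⟩ := fun k => Nat.not_lt_zero k
    simp [newtonMatrix, newtonFactor, h0]
  · intro k _ hk
    rw [Matrix.single_mul_apply_of_ne _ _ _ _ _ hk, mul_zero]
  · simp

/-! ### The linear system for the interpolating matrix -/

/-- The operator `K ↦ (1 - A - B)² K - t A K Bᵀ`, where `A` acts on the left and `B` through its
transpose on the right, on vectorized matrices. -/
def quadOperator (t : ℂ) (A B : Matrix (Fin n) (Fin n) ℂ) :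
    Matrix (Fin n × Fin n) (Fin n × Fin n) ℂ :=
  (1 - 1 ⊗ₖ A - B ⊗ₖ 1) ^ 2 - t • ((1 ⊗ₖ A) * (B ⊗ₖ 1))

lemma left_mulVec_vec (A X : Matrix (Fin n) (Fin n) ℂ) :
    ((1 : Matrix (Fin n) (Fin n) ℂ) ⊗ₖ A) *ᵥ vec X = vec (A * X) := by
  rw [kronecker_mulVec_vec, transpose_one, Matrix.mul_one]

lemma right_mulVec_vec (B X : Matrix (Fin n) (Fin n) ℂ) :
    (B ⊗ₖ (1 : Matrix (Fin n) (Fin n) ℂ)) *ᵥ vec X = vec (X * Bᵀ) := by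
  rw [kronecker_mulVec_vec, Matrix.one_mul]

lemma quadOperator_mulVec_vec (t : ℂ) (A B K : Matrix (Fin n) (Fin n) ℂ) :
    quadOperator t A B *ᵥ vec K
      = vec (K - A * K - K * Bᵀ - A * (K - A * K - K * Bᵀ) - (K - A * K - K * Bᵀ) * Bᵀ
          - t • (A * (K * Bᵀ))) := by
  have h : ∀ X : Matrix (Fin n) (Fin n) ℂ, (1 - 1 ⊗ₖ A - B ⊗ₖ 1) *ᵥ vec X
      = vec (X - A * X - X * Bᵀ) := fun X => by
    rw [Matrix.sub_mulVec, Matrix.sub_mulVec, Matrix.one_mulVec, left_mulVec_vec,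
      right_mulVec_vec, vec_sub, vec_sub]
  rw [quadOperator, Matrix.sub_mulVec, sq, ← Matrix.mulVec_mulVec, h, h, Matrix.smul_mulVec,
    ← Matrix.mulVec_mulVec, right_mulVec_vec, left_mulVec_vec, ← vec_smul, ← vec_sub]

lemma newtonShift_zero_pow_apply (m : ℕ) (r s : Fin n) :
    (newtonShift (0 : Fin n → ℂ) ^ m) r s = if (r : ℕ) = s + m then 1 else 0 := by
  induction m generalizing r s with
  | zero => simp [Matrix.one_apply, Fin.ext_iff]
  | succ m ih =>
    rw [pow_succ, Matrix.mul_apply]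
    have hz : ∀ k : Fin n, newtonShift (0 : Fin n → ℂ) k s = if (k : ℕ) = s + 1 then 1 else 0 :=
      fun k => by simp [newtonShift]
    simp only [ih, hz]
    by_cases hs : (s : ℕ) + 1 < n
    · rw [Finset.sum_eq_single (⟨s + 1, hs⟩ : Fin n)]
      · simp [add_assoc, add_comm 1 m]
      · intro k _ hk
        rw [if_neg (c := (k : ℕ) = s + 1) fun h => hk (Fin.ext h), mul_zero]
      · simp
    · rw [if_neg (by omega)]
      refine Finset.sum_eq_zero fun k _ => ?_
      rw [if_neg (c := (k : ℕ) = s + 1) (by omega), mul_zero]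

lemma isNilpotent_newtonShift_zero : IsNilpotent (newtonShift (0 : Fin n → ℂ)) :=
  ⟨n, by ext r s; rw [newtonShift_zero_pow_apply, if_neg (by omega)]; rfl⟩

lemma isNilpotent_left {A : Matrix (Fin n) (Fin n) ℂ} (hA : IsNilpotent A) :
    IsNilpotent ((1 : Matrix (Fin n) (Fin n) ℂ) ⊗ₖ A) := by
  obtain ⟨m, hm⟩ := hA
  refine ⟨m, ?_⟩
  have h : ∀ k : ℕ, ((1 : Matrix (Fin n) (Fin n) ℂ) ⊗ₖ A) ^ k = 1 ⊗ₖ (A ^ k) := fun k => by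
    induction k with
    | zero => simp
    | succ k ih => rw [pow_succ, ih, ← Matrix.mul_kronecker_mul, Matrix.one_mul, pow_succ]
  rw [h, hm, Matrix.kronecker_zero]

lemma isNilpotent_right {B : Matrix (Fin n) (Fin n) ℂ} (hB : IsNilpotent B) :
    IsNilpotent (B ⊗ₖ (1 : Matrix (Fin n) (Fin n) ℂ)) := by
  obtain ⟨m, hm⟩ := hB
  refine ⟨m, ?_⟩
  have h : ∀ k : ℕ, (B ⊗ₖ (1 : Matrix (Fin n) (Fin n) ℂ)) ^ k = (B ^ k) ⊗ₖ 1 := fun k => by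
    induction k with
    | zero => simp
    | succ k ih => rw [pow_succ, ih, ← Matrix.mul_kronecker_mul, Matrix.one_mul, pow_succ]
  rw [h, hm, Matrix.zero_kronecker]

/-- The two one-sided multiplications commute and are nilpotent, so the operator is a unit plus a
commuting nilpotent. -/
lemma isUnit_quadOperator (t : ℂ) {A B : Matrix (Fin n) (Fin n) ℂ} (hA : IsNilpotent A)
    (hB : IsNilpotent B) : IsUnit (quadOperator t A B) := by
  have hc : Commute ((1 : Matrix (Fin n) (Fin n) ℂ) ⊗ₖ A) (B ⊗ₖ 1) := by
    rw [Commute, SemiconjBy, ← Matrix.mul_kronecker_mul, ← Matrix.mul_kronecker_mul]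
    simp
  have hα := isNilpotent_left hA
  have hβ := isNilpotent_right hB
  rw [quadOperator]
  generalize (1 : Matrix (Fin n) (Fin n) ℂ) ⊗ₖ A = α at *
  generalize B ⊗ₖ (1 : Matrix (Fin n) (Fin n) ℂ) = β at *
  have h1 : IsUnit ((1 - α - β) ^ 2) := by
    rw [sub_sub]
    exact (hc.isNilpotent_add hα hβ).isUnit_one_sub.pow 2
  have h2 : IsNilpotent (-(t • (α * β))) := by
    rw [isNilpotent_neg_iff]
    exact (hc.isNilpotent_mul_right hα).smul t
  have h3 : Commute (α * β) (1 - α - β) := by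
    refine ((Commute.one_right _).sub_right ?_).sub_right ?_
    · exact (Commute.refl α).mul_left hc.symm
    · exact hc.mul_left (Commute.refl β)
  rw [sub_eq_add_neg]
  exact h2.isUnit_add_left_of_commute h1 ((h3.smul_left t).neg_left.pow_right 2)

/-- The right-hand side of the linear system satisfied by the interpolating matrix. -/
def sourceMatrix (e₀ e₁ e₂ : ℂ) (A B : Matrix (Fin n) (Fin n) ℂ) : Matrix (Fin n) (Fin n) ℂ :=
  e₀ • (cornerMatrix n - A * cornerMatrix n - cornerMatrix n * Bᵀ)
    + e₁ • (A * cornerMatrix n) + e₂ • (cornerMatrix n * Bᵀ)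

/-- The matrix in the Newton bases at the nodes `u` and `v` of the function
`(e₀ (1 - U - V) + e₁ U + e₂ V) / ((1 - U - V)² - t U V)`. -/
def interpMatrix (t e₀ e₁ e₂ : ℂ) (u v : Fin n → ℂ) : Matrix (Fin n) (Fin n) ℂ :=
  Matrix.of fun i j => ((quadOperator t (newtonShift u) (newtonShift v))⁻¹
    *ᵥ vec (sourceMatrix e₀ e₁ e₂ (newtonShift u) (newtonShift v))) (j, i)

lemma quadOperator_mulVec_interpMatrix (t e₀ e₁ e₂ : ℂ) (u v : Fin n → ℂ)
    (h : IsUnit (quadOperator t (newtonShift u) (newtonShift v)).det) :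
    quadOperator t (newtonShift u) (newtonShift v) *ᵥ vec (interpMatrix t e₀ e₁ e₂ u v)
      = vec (sourceMatrix e₀ e₁ e₂ (newtonShift u) (newtonShift v)) := by
  have : vec (interpMatrix t e₀ e₁ e₂ u v) = (quadOperator t (newtonShift u) (newtonShift v))⁻¹
      *ᵥ vec (sourceMatrix e₀ e₁ e₂ (newtonShift u) (newtonShift v)) := by
    ext ⟨j, i⟩
    rfl
  rw [this, Matrix.mulVec_mulVec, Matrix.mul_nonsing_inv _ h, Matrix.one_mulVec]

/-- Evaluation at `(u i, v j)` turns left multiplication by the shift into the scalar `u i` and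
right multiplication by its transpose into `v j`, so the matrix system becomes a scalar equation. -/
lemma newton_conj_interpMatrix (t e₀ e₁ e₂ : ℂ) (u v : Fin n → ℂ)
    (h : IsUnit (quadOperator t (newtonShift u) (newtonShift v)).det) (i j : Fin n) :
    ((1 - u i - v j) ^ 2 - t * u i * v j)
        * (newtonMatrix u * interpMatrix t e₀ e₁ e₂ u v * (newtonMatrix v)ᵀ) i j
      = e₀ * (1 - u i - v j) + e₁ * u i + e₂ * v j := by
  obtain ⟨φ, hφ⟩ : ∃ φ : Matrix (Fin n) (Fin n) ℂ → ℂ,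
      ∀ X, (newtonMatrix u * X * (newtonMatrix v)ᵀ) i j = φ X := ⟨_, fun _ => rfl⟩
  have hl : ∀ X, φ (newtonShift u * X) = u i * φ X := fun X => by
    rw [← hφ, ← hφ, ← Matrix.mul_assoc, newtonMatrix_mul_newtonShift, Matrix.mul_assoc,
      Matrix.mul_assoc, Matrix.diagonal_mul, Matrix.mul_assoc]
  have hr : ∀ X, φ (X * (newtonShift v)ᵀ) = φ X * v j := fun X => by
    rw [← hφ, ← hφ, Matrix.mul_assoc, Matrix.mul_assoc, ← Matrix.transpose_mul,
      newtonMatrix_mul_newtonShift, Matrix.transpose_mul, Matrix.diagonal_transpose,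
      ← Matrix.mul_assoc, ← Matrix.mul_assoc, Matrix.mul_diagonal]
  have hsub : ∀ X Y, φ (X - Y) = φ X - φ Y := fun X Y => by
    rw [← hφ, ← hφ, ← hφ, Matrix.mul_sub, Matrix.sub_mul, Matrix.sub_apply]
  have hadd : ∀ X Y, φ (X + Y) = φ X + φ Y := fun X Y => by
    rw [← hφ, ← hφ, ← hφ, Matrix.mul_add, Matrix.add_mul, Matrix.add_apply]
  have hsmul : ∀ (e : ℂ) X, φ (e • X) = e * φ X := fun e X => by
    rw [← hφ, ← hφ, Matrix.mul_smul, Matrix.smul_mul, Matrix.smul_apply, smul_eq_mul]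
  have hone : φ (cornerMatrix n) = 1 := by rw [← hφ, newtonMatrix_mul_cornerMatrix_mul]
  have key := quadOperator_mulVec_interpMatrix t e₀ e₁ e₂ u v h
  rw [quadOperator_mulVec_vec, vec_inj] at key
  have key' := congrArg φ key
  simp only [sourceMatrix, hsub, hadd, hsmul, hl, hr, hone] at key'
  rw [hφ]
  linear_combination key'

/-! ### Continuity at coalescing nodes -/

lemma continuous_newtonShift :
    Continuous (newtonShift : (Fin n → ℂ) → Matrix (Fin n) (Fin n) ℂ) := by
  refine continuous_matrix fun r s => ?_
  simp only [newtonShift, Matrix.of_apply]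
  split_ifs <;> fun_prop

lemma continuous_quadOperator (t : ℂ) :
    Continuous fun p : (Fin n → ℂ) × (Fin n → ℂ) =>
      quadOperator t (newtonShift p.1) (newtonShift p.2) := by
  have h1 : Continuous fun p : (Fin n → ℂ) × (Fin n → ℂ) =>
      (1 : Matrix (Fin n) (Fin n) ℂ) ⊗ₖ newtonShift p.1 :=
    continuous_matrix fun r s => continuous_const.mul
      ((continuous_newtonShift.comp continuous_fst).matrix_elem _ _)
  have h2 : Continuous fun p : (Fin n → ℂ) × (Fin n → ℂ) =>
      newtonShift p.2 ⊗ₖ (1 : Matrix (Fin n) (Fin n) ℂ) :=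
    continuous_matrix fun r s =>
      ((continuous_newtonShift.comp continuous_snd).matrix_elem _ _).mul continuous_const
  exact (((continuous_const.sub h1).sub h2).pow 2).sub ((h1.mul h2).const_smul t)

lemma isUnit_det_quadOperator_zero (t : ℂ) :
    IsUnit (quadOperator t (newtonShift (0 : Fin n → ℂ)) (newtonShift (0 : Fin n → ℂ))).det :=
  (Matrix.isUnit_iff_isUnit_det _).1
    (isUnit_quadOperator t isNilpotent_newtonShift_zero isNilpotent_newtonShift_zero)

lemma eventually_isUnit_det_quadOperator (t : ℂ) :
    ∀ᶠ p : (Fin n → ℂ) × (Fin n → ℂ) in 𝓝 (0, 0),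
      IsUnit (quadOperator t (newtonShift p.1) (newtonShift p.2)).det := by
  simp only [isUnit_iff_ne_zero]
  exact (continuous_quadOperator t).matrix_det.continuousAt.eventually_ne
    (isUnit_det_quadOperator_zero t).ne_zero

lemma continuousAt_interpMatrix (t e₀ e₁ e₂ : ℂ) :
    ContinuousAt (fun p : (Fin n → ℂ) × (Fin n → ℂ) => interpMatrix t e₀ e₁ e₂ p.1 p.2) (0, 0) := by
  have hs : Continuous fun p : (Fin n → ℂ) × (Fin n → ℂ) =>
      sourceMatrix e₀ e₁ e₂ (newtonShift p.1) (newtonShift p.2) := by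
    have h1 := continuous_newtonShift.comp
      (continuous_fst : Continuous (Prod.fst : (Fin n → ℂ) × (Fin n → ℂ) → _))
    have h2 := continuous_newtonShift.comp
      (continuous_snd : Continuous (Prod.snd : (Fin n → ℂ) × (Fin n → ℂ) → _))
    unfold sourceMatrix
    simp only [Function.comp_def] at h1 h2
    fun_prop
  have hi : ContinuousAt (fun p : (Fin n → ℂ) × (Fin n → ℂ) =>
      (quadOperator t (newtonShift p.1) (newtonShift p.2))⁻¹) (0, 0) := by
    simp only [Matrix.inv_def, Ring.inverse_eq_inv']
    have hd := (continuous_quadOperator (n := n) t).matrix_det.continuousAt (x := (0, 0))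
    exact (hd.inv₀ (isUnit_det_quadOperator_zero t).ne_zero).smul
      (continuous_quadOperator t).matrix_adjugate.continuousAt
  refine continuousAt_pi.2 fun i => continuousAt_pi.2 fun j => ?_
  simp only [interpMatrix, Matrix.of_apply, Matrix.mulVec, dotProduct]
  refine tendsto_finsetSum _ fun k _ => ?_
  refine ContinuousAt.mul ?_ ?_
  · exact continuousAt_pi.1 (continuousAt_pi.1 hi (j, i)) k
  · exact (hs.matrix_elem k.2 k.1).continuousAt

/-- The solution of the linear system at the origin is the interpolating matrix there. -/
lemma interpMatrix_zero_eq (t e₀ e₁ e₂ : ℂ) (K : Matrix (Fin n) (Fin n) ℂ)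
    (h : quadOperator t (newtonShift 0) (newtonShift 0) *ᵥ vec K
      = vec (sourceMatrix e₀ e₁ e₂ (newtonShift 0) (newtonShift 0))) :
    interpMatrix t e₀ e₁ e₂ 0 0 = K := by
  ext i j
  rw [interpMatrix, Matrix.of_apply, ← h, Matrix.mulVec_mulVec,
    Matrix.nonsing_inv_mul _ (isUnit_det_quadOperator_zero t), Matrix.one_mulVec]
  rfl

/-! ### The expansion as a power series in two variables -/

/-- `1 / (1 - U - V) ^ (r + 1)` as a power series, where `U` and `V` are the inner and the outer
variable. -/
def geomSeries (r : ℕ) : PowerSeries (PowerSeries ℂ) :=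
  PowerSeries.mk fun b => PowerSeries.mk fun a =>
    ((Nat.choose (a + b + r) (a + r) * Nat.choose (a + r) r : ℕ) : ℂ)

/-- The inner variable. -/
def innerVar : PowerSeries (PowerSeries ℂ) := PowerSeries.C PowerSeries.X

/-- The outer variable. -/
def outerVar : PowerSeries (PowerSeries ℂ) := PowerSeries.X

/-- The coefficient of `U ^ i V ^ j`. -/
def biCoeff (i j : ℕ) (f : PowerSeries (PowerSeries ℂ)) : ℂ :=
  PowerSeries.coeff i (PowerSeries.coeff j f)

lemma biCoeff_add (i j : ℕ) (f g : PowerSeries (PowerSeries ℂ)) :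
    biCoeff i j (f + g) = biCoeff i j f + biCoeff i j g := by simp [biCoeff]

lemma biCoeff_sub (i j : ℕ) (f g : PowerSeries (PowerSeries ℂ)) :
    biCoeff i j (f - g) = biCoeff i j f - biCoeff i j g := by simp [biCoeff]

lemma biCoeff_sum {ι : Type*} (i j : ℕ) (s : Finset ι) (f : ι → PowerSeries (PowerSeries ℂ)) :
    biCoeff i j (∑ k ∈ s, f k) = ∑ k ∈ s, biCoeff i j (f k) := by simp [biCoeff]

lemma biCoeff_smul (i j : ℕ) (c : ℂ) (f : PowerSeries (PowerSeries ℂ)) :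
    biCoeff i j (c • f) = c * biCoeff i j f := by simp [biCoeff]

lemma biCoeff_innerVar_pow_mul (i j k : ℕ) (f : PowerSeries (PowerSeries ℂ)) :
    biCoeff i j (innerVar ^ k * f) = if k ≤ i then biCoeff (i - k) j f else 0 := by
  rw [biCoeff, innerVar, ← map_pow, PowerSeries.coeff_C_mul, PowerSeries.coeff_X_pow_mul']
  rfl

lemma biCoeff_outerVar_pow_mul (i j k : ℕ) (f : PowerSeries (PowerSeries ℂ)) :
    biCoeff i j (outerVar ^ k * f) = if k ≤ j then biCoeff i (j - k) f else 0 := by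
  rw [biCoeff, outerVar, PowerSeries.coeff_X_pow_mul']
  split_ifs <;> simp [biCoeff]

lemma biCoeff_innerVar_mul (i j : ℕ) (f : PowerSeries (PowerSeries ℂ)) :
    biCoeff i j (innerVar * f) = if 1 ≤ i then biCoeff (i - 1) j f else 0 := by
  simpa using biCoeff_innerVar_pow_mul i j 1 f

lemma biCoeff_outerVar_mul (i j : ℕ) (f : PowerSeries (PowerSeries ℂ)) :
    biCoeff i j (outerVar * f) = if 1 ≤ j then biCoeff i (j - 1) f else 0 := by
  simpa using biCoeff_outerVar_pow_mul i j 1 f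

lemma biCoeff_geomSeries (i j r : ℕ) : biCoeff i j (geomSeries r)
    = (Nat.choose (i + j + r) (i + r) * Nat.choose (i + r) r : ℕ) := by
  simp [biCoeff, geomSeries]

lemma biCoeff_one (i j : ℕ) : biCoeff i j 1 = if i = 0 ∧ j = 0 then 1 else 0 := by
  rw [biCoeff, PowerSeries.coeff_one]
  by_cases hj : j = 0 <;> simp [hj, PowerSeries.coeff_one]

lemma biCoeff_ext {f g : PowerSeries (PowerSeries ℂ)} (h : ∀ i j, biCoeff i j f = biCoeff i j g) :
    f = g := by
  ext j i
  exact h i j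

lemma mul_geomSeries_zero : (1 - innerVar - outerVar) * geomSeries 0 = 1 := by
  refine biCoeff_ext fun i j => ?_
  rw [sub_mul, sub_mul, one_mul, biCoeff_sub, biCoeff_sub, biCoeff_innerVar_mul,
    biCoeff_outerVar_mul, biCoeff_one]
  simp only [biCoeff_geomSeries]
  rcases i with _ | i <;> rcases j with _ | j <;> simp
  have := Nat.choose_succ_succ' (i + j + 1) i
  have e1 : i + 1 + (j + 1) = i + j + 1 + 1 := by ring
  have e2 : i + 1 + j = i + j + 1 := by ring
  have e3 : i + (j + 1) = i + j + 1 := by ring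
  rw [e1, e2, e3, this]
  push_cast
  ring

/-- The coefficients are the trinomials `(i + j + r)! / (i! j! r!)`, and the claim is their Pascal
recurrence, obtained from two binomial ones. -/
lemma mul_geomSeries_succ (r : ℕ) :
    (1 - innerVar - outerVar) * geomSeries (r + 1) = geomSeries r := by
  refine biCoeff_ext fun i j => ?_
  rw [sub_mul, sub_mul, one_mul, biCoeff_sub, biCoeff_sub, biCoeff_innerVar_mul,
    biCoeff_outerVar_mul]
  simp only [biCoeff_geomSeries]
  rcases i with _ | i <;> rcases j with _ | j
  · simp
  · have h1 := Nat.choose_succ_succ' (j + r + 1) r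
    have e1 : j + 1 + (r + 1) = j + r + 1 + 1 := by ring
    have e2 : j + 1 + r = j + r + 1 := by ring
    have e3 : j + (r + 1) = j + r + 1 := by ring
    simp only [zero_add, Nat.add_sub_cancel, e1, e2, e3, Nat.choose_self, h1]
    simp
  · have h1 := Nat.choose_succ_succ' (i + r + 1) r
    have e1 : i + 1 + (r + 1) = i + r + 1 + 1 := by ring
    have e2 : i + 1 + r = i + r + 1 := by ring
    have e3 : i + 1 - 1 = i := rfl
    simp only [e1, e2, e3, add_zero, Nat.choose_self, one_mul, h1, ← add_assoc]
    simp
  · have h1 := Nat.choose_succ_succ' (i + j + r + 2) (i + r + 1)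
    have h2 := Nat.choose_succ_succ' (i + r + 1) r
    have e1 : i + 1 + (j + 1) + (r + 1) = i + j + r + 2 + 1 := by ring
    have e2 : i + 1 + (r + 1) = i + r + 1 + 1 := by ring
    have e3 : i + (j + 1) + (r + 1) = i + j + r + 2 := by ring
    have e4 : i + 1 + j + (r + 1) = i + j + r + 2 := by ring
    have e5 : i + (r + 1) = i + r + 1 := by ring
    have e6 : i + 1 + (j + 1) + r = i + j + r + 2 := by ring
    have e7 : i + 1 + r = i + r + 1 := by ring
    simp only [Nat.add_sub_cancel, e1, e2, e3, e4, e5, e6, e7, h1, h2]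
    simp
    ring

/-- The coefficient of `(t U V) ^ k` in the expansion of
`(e₀ (1 - U - V) + t (e₁ U + e₂ V)) / ((1 - U - V)² - t U V)` in powers of `U V`. -/
def seriesTerm (t e₀ e₁ e₂ : ℂ) (k : ℕ) : PowerSeries (PowerSeries ℂ) :=
  e₀ • geomSeries (2 * k) + (t * e₁) • (innerVar * geomSeries (2 * k + 1))
    + (t * e₂) • (outerVar * geomSeries (2 * k + 1))

/-- A partial sum of the expansion of
`(e₀ (1 - U - V) + t (e₁ U + e₂ V)) / ((1 - U - V)² - t U V)`. -/
def partialSeries (t e₀ e₁ e₂ : ℂ) (m : ℕ) : PowerSeries (PowerSeries ℂ) :=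
  ∑ k ∈ Finset.range m, t ^ k • (innerVar ^ k * (outerVar ^ k * seriesTerm t e₀ e₁ e₂ k))

lemma sq_mul_seriesTerm_zero (t e₀ e₁ e₂ : ℂ) :
    (1 - innerVar - outerVar) ^ 2 * seriesTerm t e₀ e₁ e₂ 0
      = e₀ • (1 - innerVar - outerVar) + (t * e₁) • innerVar + (t * e₂) • outerVar := by
  have h0 := mul_geomSeries_zero
  have h1 := mul_geomSeries_succ 0
  simp only [seriesTerm, Algebra.smul_def, mul_zero]
  simp only [zero_add] at h1 ⊢
  generalize algebraMap ℂ (PowerSeries (PowerSeries ℂ)) = a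
  rw [← h1] at h0
  linear_combination (a e₀ * (1 - innerVar - outerVar) + a (t * e₁) * innerVar
    + a (t * e₂) * outerVar) * h0 + a e₀ * (1 - innerVar - outerVar) ^ 2 * (-h1)

/-- Lowering the index by one is what makes the partial sums telescope under multiplication by `(1 -
U - V)² - t U V`. -/
lemma sq_mul_seriesTerm_succ (t e₀ e₁ e₂ : ℂ) (k : ℕ) :
    (1 - innerVar - outerVar) ^ 2 * seriesTerm t e₀ e₁ e₂ (k + 1) = seriesTerm t e₀ e₁ e₂ k := by
  have h0 := mul_geomSeries_succ (2 * k)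
  have h1 := mul_geomSeries_succ (2 * k + 1)
  have h2 := mul_geomSeries_succ (2 * k + 2)
  simp only [seriesTerm, Algebra.smul_def, mul_add, mul_one]
  simp only [add_assoc, Nat.reduceAdd] at h0 h1 h2 ⊢
  generalize algebraMap ℂ (PowerSeries (PowerSeries ℂ)) = a
  linear_combination a e₀ * (h0 + (1 - innerVar - outerVar) * h1)
    + (a (t * e₁) * innerVar + a (t * e₂) * outerVar) * (h1 + (1 - innerVar - outerVar) * h2)

/-- Multiplication by `(1 - U - V)² - t U V` turns the partial expansion into the numerator, up to
a term divisible by `(U V) ^ m`. -/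
lemma quad_mul_partialSeries (t e₀ e₁ e₂ : ℂ) (m : ℕ) :
    (1 - innerVar - outerVar) ^ 2 * partialSeries t e₀ e₁ e₂ m
        - t • (innerVar * (outerVar * partialSeries t e₀ e₁ e₂ m))
      = e₀ • (1 - innerVar - outerVar) + (t * e₁) • innerVar + (t * e₂) • outerVar
        - innerVar ^ m * (t ^ m • (outerVar ^ m * ((1 - innerVar - outerVar) ^ 2
            * seriesTerm t e₀ e₁ e₂ m))) := by
  induction m with
  | zero => simp [partialSeries, sq_mul_seriesTerm_zero]
  | succ m ih =>
    rw [sq_mul_seriesTerm_succ]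
    have h : partialSeries t e₀ e₁ e₂ (m + 1) = partialSeries t e₀ e₁ e₂ m
        + t ^ m • (innerVar ^ m * (outerVar ^ m * seriesTerm t e₀ e₁ e₂ m)) :=
      Finset.sum_range_succ _ _
    rw [h]
    simp only [Algebra.smul_def, map_pow] at ih ⊢
    linear_combination ih

/-! ### Taylor coefficients solve the system at the origin -/

/-- The matrix of the low-order coefficients of a power series in two variables. -/
def coeffMatrix (n : ℕ) (f : PowerSeries (PowerSeries ℂ)) : Matrix (Fin n) (Fin n) ℂ :=
  Matrix.of fun i j => biCoeff i j f

lemma coeffMatrix_add (f g : PowerSeries (PowerSeries ℂ)) :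
    coeffMatrix n (f + g) = coeffMatrix n f + coeffMatrix n g := by
  ext i j
  exact biCoeff_add _ _ _ _

lemma coeffMatrix_sub (f g : PowerSeries (PowerSeries ℂ)) :
    coeffMatrix n (f - g) = coeffMatrix n f - coeffMatrix n g := by
  ext i j
  exact biCoeff_sub _ _ _ _

lemma coeffMatrix_smul (c : ℂ) (f : PowerSeries (PowerSeries ℂ)) :
    coeffMatrix n (c • f) = c • coeffMatrix n f := by
  ext i j
  exact biCoeff_smul _ _ _ _

lemma coeffMatrix_one : coeffMatrix n 1 = cornerMatrix n := by
  ext i j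
  exact biCoeff_one _ _

/-- The remainder of the `n`-th partial sum is divisible by `U ^ n`, hence invisible in the `n × n`
block. -/
lemma coeffMatrix_innerVar_pow_mul_self (f : PowerSeries (PowerSeries ℂ)) :
    coeffMatrix n (innerVar ^ n * f) = 0 := by
  ext i j
  rw [coeffMatrix, Matrix.of_apply, biCoeff_innerVar_pow_mul, if_neg (by omega)]
  rfl

lemma newtonShift_zero_mul_apply (X : ℕ → ℕ → ℂ) (i j : Fin n) :
    (newtonShift (0 : Fin n → ℂ) * Matrix.of fun i j : Fin n => X i j) i j
      = if 1 ≤ (i : ℕ) then X (i - 1) j else 0 := by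
  have hz : ∀ k : Fin n, newtonShift (0 : Fin n → ℂ) i k = if (i : ℕ) = k + 1 then 1 else 0 :=
    fun k => by simp [newtonShift]
  simp only [Matrix.mul_apply, hz, Matrix.of_apply, ite_mul, one_mul, zero_mul]
  split_ifs with hi
  · rw [Finset.sum_eq_single (⟨i - 1, by omega⟩ : Fin n)]
    · rw [if_pos (by simp; omega)]
    · intro k _ hk
      refine if_neg fun h => hk (Fin.ext ?_)
      simp; omega
    · simp
  · exact Finset.sum_eq_zero fun k _ => if_neg (by omega)

lemma coeffMatrix_innerVar_mul (f : PowerSeries (PowerSeries ℂ)) :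
    coeffMatrix n (innerVar * f) = newtonShift 0 * coeffMatrix n f := by
  ext i j
  rw [coeffMatrix, coeffMatrix, newtonShift_zero_mul_apply fun i j => biCoeff i j f]
  exact biCoeff_innerVar_mul _ _ _

lemma coeffMatrix_outerVar_mul (f : PowerSeries (PowerSeries ℂ)) :
    coeffMatrix n (outerVar * f) = coeffMatrix n f * (newtonShift 0)ᵀ := by
  rw [← Matrix.transpose_inj, Matrix.transpose_mul, Matrix.transpose_transpose]
  ext i j
  refine Eq.trans ?_ (newtonShift_zero_mul_apply (fun i j => biCoeff j i f) i j).symm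
  exact biCoeff_outerVar_mul _ _ _

lemma interpMatrix_zero (t e₀ e₁ e₂ : ℂ) :
    interpMatrix t e₀ (t * e₁) (t * e₂) (0 : Fin n → ℂ) 0
      = coeffMatrix n (partialSeries t e₀ e₁ e₂ n) := by
  apply interpMatrix_zero_eq
  rw [quadOperator_mulVec_vec, vec_inj]
  have h := congrArg (coeffMatrix n) (quad_mul_partialSeries t e₀ e₁ e₂ n)
  have hi := coeffMatrix_innerVar_mul (n := n) 1
  have ho := coeffMatrix_outerVar_mul (n := n) 1
  rw [mul_one, coeffMatrix_one] at hi ho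
  generalize partialSeries t e₀ e₁ e₂ n = f at *
  have hf : (1 - innerVar - outerVar) ^ 2 * f
      = f - innerVar * f - outerVar * f - innerVar * (f - innerVar * f - outerVar * f)
        - outerVar * (f - innerVar * f - outerVar * f) := by ring
  rw [hf] at h
  simp only [coeffMatrix_sub, coeffMatrix_add, coeffMatrix_smul, coeffMatrix_innerVar_pow_mul_self,
    coeffMatrix_innerVar_mul, coeffMatrix_outerVar_mul, coeffMatrix_one, hi, ho, sub_zero] at h
  exact h

lemma coeffMatrix_partialSeries_apply (t e₀ e₁ e₂ : ℂ) (i j : Fin n) :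
    coeffMatrix n (partialSeries t e₀ e₁ e₂ n) i j = ∑ k ∈ Finset.range n,
      (e₀ * (Nat.choose (i + j) (i + k) : ℂ) * (Nat.choose (i + k) (2 * k) : ℂ) * t ^ k
        + (e₁ * (Nat.choose (i + j) (i + k) : ℂ) * (Nat.choose (i + k) (2 * k + 1) : ℂ)
          + e₂ * (Nat.choose (i + j) (i + k + 1) : ℂ)
            * (Nat.choose (i + k + 1) (2 * k + 1) : ℂ)) * t ^ (k + 1)) := by
  rw [coeffMatrix, Matrix.of_apply, partialSeries, biCoeff_sum]
  refine Finset.sum_congr rfl fun k _ => ?_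
  simp only [seriesTerm, biCoeff_smul, biCoeff_innerVar_pow_mul, biCoeff_outerVar_pow_mul,
    biCoeff_add, biCoeff_innerVar_mul, biCoeff_outerVar_mul, biCoeff_geomSeries]
  generalize (i : ℕ) = i
  generalize (j : ℕ) = j
  have h0 : ∀ {a b : ℕ}, a < b → ((Nat.choose a b : ℕ) : ℂ) = 0 := fun h => by
    rw [Nat.choose_eq_zero_of_lt h, Nat.cast_zero]
  by_cases hi : k ≤ i
  · by_cases hj : k ≤ j
    · obtain ⟨a, rfl⟩ := Nat.exists_eq_add_of_le hi
      obtain ⟨b, rfl⟩ := Nat.exists_eq_add_of_le hj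
      simp only [hi, hj, if_true, Nat.add_sub_cancel_left]
      -- At `a = 0` the term with an extra `U` is absent, and the binomial on the right vanishes as
      -- well; `e2` treats `b = 0` likewise.
      have e1 : (if 1 ≤ a then ((Nat.choose (a - 1 + b + (2 * k + 1)) (a - 1 + (2 * k + 1))
          * Nat.choose (a - 1 + (2 * k + 1)) (2 * k + 1) : ℕ) : ℂ) else 0)
          = (Nat.choose (k + a + (k + b)) (k + a + k) : ℂ)
            * (Nat.choose (k + a + k) (2 * k + 1) : ℂ) := by
        split_ifs with ha
        · rw [show a - 1 + b + (2 * k + 1) = k + a + (k + b) by omega,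
            show a - 1 + (2 * k + 1) = k + a + k by omega, Nat.cast_mul]
        · rw [h0 (show k + a + k < 2 * k + 1 by omega), mul_zero]
      have e2 : (if 1 ≤ b then ((Nat.choose (a + (b - 1) + (2 * k + 1)) (a + (2 * k + 1))
          * Nat.choose (a + (2 * k + 1)) (2 * k + 1) : ℕ) : ℂ) else 0)
          = (Nat.choose (k + a + (k + b)) (k + a + k + 1) : ℂ)
            * (Nat.choose (k + a + k + 1) (2 * k + 1) : ℂ) := by
        split_ifs with hb
        · rw [show a + (b - 1) + (2 * k + 1) = k + a + (k + b) by omega,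
            show a + (2 * k + 1) = k + a + k + 1 by omega, Nat.cast_mul]
        · rw [h0 (show k + a + (k + b) < k + a + k + 1 by omega), zero_mul]
      rw [e1, e2, show a + b + 2 * k = k + a + (k + b) by ring,
        show a + 2 * k = k + a + k by ring]
      push_cast
      ring
    · rw [if_neg hj, h0 (show i + j < i + k by omega), h0 (show i + j < i + k + 1 by omega)]
      simp
  · rw [if_neg hi, h0 (show i + k < 2 * k by omega), h0 (show i + k < 2 * k + 1 by omega),
      h0 (show i + k + 1 < 2 * k + 1 by omega)]
    simp

/-! ### Bracket identities for the entries and the prefactor -/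

/-- The variable `([w] / [q])²`. -/
def scaledSq (q w : ℂ) : ℂ := (bracket w / bracket q) ^ 2

lemma bracket_sq (q : ℂ) (hq : q ≠ 0) : bracket (q ^ 2) = bracket q * (q + q⁻¹) := by
  simp only [bracket]
  field_simp
  ring

/-- The product is invariant under `x ↦ 1/x` and `y ↦ 1/y`, which is why it can be written in `[x]²`
and `[y]²`. -/
lemma prod_bracket_eq {q x y : ℂ} (hq : q ≠ 0) (hx : x ≠ 0) (hy : y ≠ 0) (hs : bracket q ≠ 0) :
    bracket (q * x / y) * bracket (q * y / x) * bracket (q * x * y) * bracket (q / (x * y))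
      = bracket q ^ 4 * ((1 - scaledSq q y - scaledSq q x) ^ 2
          - tParam q * scaledSq q y * scaledSq q x) := by
  have ht : tParam q = (q + q⁻¹) ^ 2 := by
    rw [tParam, bracket_sq q hq, mul_div_cancel_left₀ _ hs]
  have h1 : bracket q ^ 4 * ((1 - scaledSq q y - scaledSq q x) ^ 2
      - tParam q * scaledSq q y * scaledSq q x)
      = (bracket q ^ 2 - bracket y ^ 2 - bracket x ^ 2) ^ 2
        - (q + q⁻¹) ^ 2 * bracket y ^ 2 * bracket x ^ 2 := by
    rw [ht, scaledSq, scaledSq]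
    field_simp
  rw [h1]
  simp only [bracket]
  field_simp
  ring

/-- An entry changes sign under `x ↦ 1/x` and under `y ↦ 1/y`; this accounts for the factor
`[x²][y²]`, whose cofactor is symmetric. -/
lemma matrixUU_numerator {q b c x y : ℂ} (hq : q ≠ 0) (hb : b ≠ 0) (hc : c ≠ 0) (hx : x ≠ 0)
    (hy : y ≠ 0) :
    bracket q * (bracket (b / y) * bracket (c * x) * (bracket (q * y / x) * bracket (q * x * y)
          * bracket (q / (x * y)))
        - bracket (b / y) * bracket (c / x) * (bracket (q * x / y) * bracket (q * y / x)
          * bracket (q * x * y))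
        + bracket (b * y) * bracket (c / x) * (bracket (q * x / y) * bracket (q * x * y)
          * bracket (q / (x * y)))
        - bracket (b * y) * bracket (c * x) * (bracket (q * x / y) * bracket (q * y / x)
          * bracket (q / (x * y))))
      = -(bracket (x ^ 2) * bracket (y ^ 2)
        * ((bracket (b / q) * bracket (c / q) + bracket b * bracket c)
            * (bracket q ^ 2 - bracket y ^ 2 - bracket x ^ 2)
          + bracket c * (q + q⁻¹) * bracket (b / q) * bracket y ^ 2
          + bracket b * (q + q⁻¹) * bracket (c / q) * bracket x ^ 2)) := by
  simp only [bracket]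
  field_simp
  ring

/-- The constant coefficient `t + (1 + y)(1 + z)`. -/
def constCoeff (q b c : ℂ) : ℂ := tParam q + (1 + boundaryParam q b) * (1 + boundaryParam q c)

lemma one_add_boundaryParam {q b : ℂ} (hq : q ≠ 0) (hb : b ≠ 0) (hbq : bracket (b / q) ≠ 0) :
    1 + boundaryParam q b = bracket b * (q + q⁻¹) / bracket (b / q) := by
  rw [boundaryParam, eq_div_iff hbq, add_mul, div_mul_cancel₀ _ hbq]
  simp only [bracket]
  field_simp
  ring

lemma matrixUU_entry {q b c x y : ℂ} (hq : q ≠ 0) (hb : b ≠ 0) (hc : c ≠ 0) (hx : x ≠ 0)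
    (hy : y ≠ 0) (hs : bracket q ≠ 0) (hbq : bracket (b / q) ≠ 0) (hcq : bracket (c / q) ≠ 0)
    (h1 : bracket (q * x / y) ≠ 0) (h2 : bracket (q * y / x) ≠ 0) (h3 : bracket (q * x * y) ≠ 0)
    (h4 : bracket (q / (x * y)) ≠ 0) :
    bracket (q ^ 2) ^ 2 * bracket q
        * (bracket (b / y) * bracket (c * x) / bracket (q * x / y)
          - bracket (b / y) * bracket (c / x) / bracket (q / (x * y))
          + bracket (b * y) * bracket (c / x) / bracket (q * y / x)
          - bracket (b * y) * bracket (c * x) / bracket (q * x * y))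
        * ((1 - scaledSq q y - scaledSq q x) ^ 2 - tParam q * scaledSq q y * scaledSq q x)
      = -(bracket (x ^ 2) * bracket (y ^ 2) * (bracket (b / q) * bracket (c / q))
        * (constCoeff q b c * (1 - scaledSq q y - scaledSq q x)
          + tParam q * (1 + boundaryParam q c) * scaledSq q y
          + tParam q * (1 + boundaryParam q b) * scaledSq q x)) := by
  have hP := prod_bracket_eq hq hx hy hs
  have hN := matrixUU_numerator hq hb hc hx hy
  have ht : tParam q = (q + q⁻¹) ^ 2 := by
    rw [tParam, bracket_sq q hq, mul_div_cancel_left₀ _ hs]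
  have hsum : ∀ {a₁ a₂ a₃ a₄ p₁ p₂ p₃ p₄ : ℂ}, p₁ ≠ 0 → p₂ ≠ 0 → p₃ ≠ 0 → p₄ ≠ 0 →
      (a₁ / p₁ - a₄ / p₄ + a₂ / p₂ - a₃ / p₃) * (p₁ * p₂ * p₃ * p₄)
        = a₁ * (p₂ * p₃ * p₄) - a₄ * (p₁ * p₂ * p₃) + a₂ * (p₁ * p₃ * p₄)
          - a₃ * (p₁ * p₂ * p₄) := by
    intros
    field_simp
  rw [← hsum h1 h2 h3 h4, hP] at hN
  have hR : bracket q ^ 2 * (bracket (b / q) * bracket (c / q)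
        * (constCoeff q b c * (1 - scaledSq q y - scaledSq q x)
          + tParam q * (1 + boundaryParam q c) * scaledSq q y
          + tParam q * (1 + boundaryParam q b) * scaledSq q x))
      = (q + q⁻¹) ^ 2 * ((bracket (b / q) * bracket (c / q) + bracket b * bracket c)
            * (bracket q ^ 2 - bracket y ^ 2 - bracket x ^ 2)
          + bracket c * (q + q⁻¹) * bracket (b / q) * bracket y ^ 2
          + bracket b * (q + q⁻¹) * bracket (c / q) * bracket x ^ 2) := by
    rw [constCoeff, one_add_boundaryParam hq hb hbq, one_add_boundaryParam hq hc hcq, ht, scaledSq,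
      scaledSq]
    field_simp
  rw [bracket_sq q hq]
  refine mul_left_cancel₀ (pow_ne_zero 2 hs) ?_
  linear_combination (q + q⁻¹) ^ 2 * hN - bracket (x ^ 2) * bracket (y ^ 2) * (-hR)

/-- Both sides equal `[w₂]² - [w₁]²`; pairing brackets this way produces the Vandermonde factors. -/
lemma denominator_pair {q w₁ w₂ : ℂ} (hs : bracket q ≠ 0) (h₁ : w₁ ≠ 0) (h₂ : w₂ ≠ 0) :
    bracket (w₂ / w₁) * bracket (w₁ * w₂)
      = bracket q ^ 2 * (scaledSq q w₂ - scaledSq q w₁) := by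
  have h : bracket q ^ 2 * (scaledSq q w₂ - scaledSq q w₁) = bracket w₂ ^ 2 - bracket w₁ ^ 2 := by
    rw [scaledSq, scaledSq]
    field_simp
  rw [h]
  simp only [bracket]
  field_simp
  ring

lemma bracket_inv (w : ℂ) : bracket w⁻¹ = -bracket w := by
  simp [bracket]

/-- Pairs above, below and on the diagonal together make up all `n * n` pairs. -/
lemma prod_Ioi_const (a : ℂ) : (∏ i : Fin n, ∏ _j ∈ Finset.Ioi i, a) ^ 2 * a ^ n = a ^ (n * n) := by
  have h : ∏ i : Fin n, ∏ _j ∈ Finset.Ioi i, a = ∏ i : Fin n, ∏ _j ∈ Finset.Iio i, a :=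
    Finset.prod_comm' (by simp)
  rw [sq]
  nth_rewrite 1 [h]
  have h2 : a ^ n = ∏ _i : Fin n, a := by simp
  rw [h2, ← Finset.prod_mul_distrib, ← Finset.prod_mul_distrib]
  simp only [Finset.prod_const, ← pow_add, ← pow_succ, Fin.card_Iio, Fin.card_Ioi]
  rw [Finset.prod_congr rfl fun i _ => by
    rw [show (i : ℕ) + (n - 1 - i) + 1 = n by omega]]
  rw [Finset.prod_const, Finset.card_univ, Fintype.card_fin, ← pow_mul]

/-- For `i < j` the signs from `[1/(x_i x_j)]` and `[y_i/y_j]` cancel; only the diagonal factors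
keep a minus sign. The power of `[q]` on the left avoids a subtraction in the exponent. -/
lemma denominatorUU_eq {q : ℂ} (hs : bracket q ≠ 0) {x y : Fin n → ℂ} (hx : ∀ i, x i ≠ 0)
    (hy : ∀ i, y i ≠ 0) :
    denominatorUU x y * bracket q ^ (2 * n)
      = (∏ i, -(bracket (x i ^ 2) * bracket (y i ^ 2))) * bracket q ^ (2 * (n * n))
        * ((∏ i, ∏ j ∈ Finset.Ioi i, (scaledSq q (x j) - scaledSq q (x i)))
          * ∏ i, ∏ j ∈ Finset.Ioi i, (scaledSq q (y j) - scaledSq q (y i))) := by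
  have h : denominatorUU x y = (∏ i, -(bracket (x i ^ 2) * bracket (y i ^ 2)))
      * ((∏ i : Fin n, ∏ _j ∈ Finset.Ioi i, bracket q ^ 2) ^ 2
        * ((∏ i, ∏ j ∈ Finset.Ioi i, (scaledSq q (x j) - scaledSq q (x i)))
          * ∏ i, ∏ j ∈ Finset.Ioi i, (scaledSq q (y j) - scaledSq q (y i)))) := by
    simp only [denominatorUU, ← Finset.prod_Ioi_mul_eq_prod_Ici, sq (∏ i : Fin n, _),
      ← Finset.prod_mul_distrib]
    refine Finset.prod_congr rfl fun i _ => ?_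
    rw [← mul_assoc, ← Finset.prod_mul_distrib, mul_comm]
    congr 1
    · rw [one_div, bracket_inv, ← sq, ← sq]
      ring
    · refine Finset.prod_congr rfl fun j _ => ?_
      have e1 := denominator_pair hs (hx i) (hx j)
      have e2 := denominator_pair hs (hy i) (hy j)
      have e3 : bracket (y i / y j) = -bracket (y j / y i) := by rw [← bracket_inv, inv_div]
      rw [one_div, bracket_inv, e3]
      linear_combination bracket (y j / y i) * bracket (y i * y j) * e1
        + bracket q ^ 2 * (scaledSq q (x j) - scaledSq q (x i)) * e2
  have hp := prod_Ioi_const (n := n) (bracket q ^ 2)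
  rw [← pow_mul, ← pow_mul] at hp
  rw [h, ← hp]
  ring

/-! ### Factorization of the normalized partition function -/

lemma numeratorUU_eq {q : ℂ} (hq : q ≠ 0) (hs : bracket q ≠ 0) {x y : Fin n → ℂ}
    (hx : ∀ i, x i ≠ 0) (hy : ∀ i, y i ≠ 0) :
    numeratorUU q x y = bracket q ^ (4 * (n * n))
      * ∏ i, ∏ j, ((1 - scaledSq q (y j) - scaledSq q (x i)) ^ 2
          - tParam q * scaledSq q (y j) * scaledSq q (x i)) := by
  simp only [numeratorUU, prod_bracket_eq hq (hx _) (hy _) hs, Finset.prod_mul_distrib,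
    Finset.prod_const, Finset.card_univ, Fintype.card_fin, ← pow_mul]
  ring

/-- The interpolating matrix of the entries of `M_UU`, rows indexed by `y`. -/
def interpUU (q b c : ℂ) (x y : Fin n → ℂ) : Matrix (Fin n) (Fin n) ℂ :=
  interpMatrix (tParam q) (constCoeff q b c) (tParam q * (1 + boundaryParam q c))
    (tParam q * (1 + boundaryParam q b)) (fun i => scaledSq q (y i)) (fun i => scaledSq q (x i))

/-- The parameters at which the entries of `M_UU` have no singularities and the interpolating
matrix is defined. -/
structure IsRegular (q : ℂ) (x y : Fin n → ℂ) : Prop where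
  x_ne : ∀ i, x i ≠ 0
  y_ne : ∀ i, y i ≠ 0
  h1 : ∀ i j, bracket (q * x i / y j) ≠ 0
  h2 : ∀ i j, bracket (q * y j / x i) ≠ 0
  h3 : ∀ i j, bracket (q * x i * y j) ≠ 0
  h4 : ∀ i j, bracket (q / (x i * y j)) ≠ 0
  isUnit : IsUnit (quadOperator (tParam q) (newtonShift fun i => scaledSq q (y i))
    (newtonShift fun i => scaledSq q (x i))).det

lemma det_matrixUU {q b c : ℂ} (hq : q ≠ 0) (hb : b ≠ 0) (hc : c ≠ 0) (hs : bracket q ≠ 0)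
    (hbq : bracket (b / q) ≠ 0) (hcq : bracket (c / q) ≠ 0) {x y : Fin n → ℂ}
    (h : IsRegular q x y) :
    (bracket (q ^ 2) ^ 2 * bracket q) ^ n * (matrixUU q b c x y).det
      = (∏ i, -(bracket (x i ^ 2) * bracket (y i ^ 2)))
        * (bracket (b / q) * bracket (c / q)) ^ n
        * ((∏ i, ∏ j ∈ Finset.Ioi i, (scaledSq q (x j) - scaledSq q (x i)))
          * ∏ i, ∏ j ∈ Finset.Ioi i, (scaledSq q (y j) - scaledSq q (y i)))
        * (interpUU q b c x y).det := by
  -- The transpose appears because the interpolating matrix has its rows indexed by `y`, while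
  -- `M_UU` has them indexed by `x`.
  have key : (bracket (q ^ 2) ^ 2 * bracket q) • matrixUU q b c x y
      = diagonal (fun i => -bracket (x i ^ 2) * (bracket (b / q) * bracket (c / q)))
        * (newtonMatrix (fun i => scaledSq q (y i)) * interpUU q b c x y
          * (newtonMatrix fun i => scaledSq q (x i))ᵀ)ᵀ
        * diagonal (fun j => bracket (y j ^ 2)) := by
    ext i j
    rw [Matrix.mul_diagonal, Matrix.diagonal_mul, Matrix.transpose_apply, Matrix.smul_apply,
      smul_eq_mul, matrixUU, Matrix.of_apply]
    have e1 := newton_conj_interpMatrix (tParam q) (constCoeff q b c)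
      (tParam q * (1 + boundaryParam q c)) (tParam q * (1 + boundaryParam q b))
      (fun i => scaledSq q (y i)) (fun i => scaledSq q (x i)) h.isUnit j i
    have e2 := matrixUU_entry hq hb hc (h.x_ne i) (h.y_ne j) hs hbq hcq (h.h1 i j) (h.h2 i j)
      (h.h3 i j) (h.h4 i j)
    have e3 := prod_bracket_eq hq (h.x_ne i) (h.y_ne j) hs
    have hD : (1 - scaledSq q (y j) - scaledSq q (x i)) ^ 2
        - tParam q * scaledSq q (y j) * scaledSq q (x i) ≠ 0 := by
      refine right_ne_zero_of_mul (a := bracket q ^ 4) ?_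
      rw [← e3]
      exact mul_ne_zero (mul_ne_zero (mul_ne_zero (h.h1 i j) (h.h2 i j)) (h.h3 i j)) (h.h4 i j)
    refine mul_right_cancel₀ hD ?_
    rw [e2, ← e1, interpUU]
    ring
  have := congrArg Matrix.det key
  rw [Matrix.det_smul, Matrix.det_mul, Matrix.det_mul, Matrix.det_transpose, Matrix.det_mul,
    Matrix.det_mul, Matrix.det_transpose, Matrix.det_diagonal, Matrix.det_diagonal,
    det_newtonMatrix, det_newtonMatrix, Fintype.card_fin] at this
  rw [this, Finset.prod_mul_distrib, Finset.prod_const, Finset.card_univ, Fintype.card_fin]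
  simp only [← neg_mul, Finset.prod_mul_distrib]
  ring

lemma normalized_ZUU2_eq {q b c : ℂ} (hq : q ≠ 0) (hb : b ≠ 0) (hc : c ≠ 0) (hs : bracket q ≠ 0)
    (hbq : bracket (b / q) ≠ 0) (hcq : bracket (c / q) ≠ 0) {x y : Fin n → ℂ}
    (h : IsRegular q x y) (hd : denominatorUU x y ≠ 0) :
    bracket (q ^ 2) ^ (2 * n) * ZUU2 q b c x y
        / (bracket q ^ (n * (2 * n + 1)) * (bracket (b / q) * bracket (c / q)) ^ n)
      = (∏ i, ∏ j, ((1 - scaledSq q (y j) - scaledSq q (x i)) ^ 2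
          - tParam q * scaledSq q (y j) * scaledSq q (x i))) * (interpUU q b c x y).det := by
  have e1 := det_matrixUU hq hb hc hs hbq hcq h
  have e2 := denominatorUU_eq hs h.x_ne h.y_ne
  have hbc : (bracket (b / q) * bracket (c / q)) ^ n ≠ 0 := pow_ne_zero _ (mul_ne_zero hbq hcq)
  have hsn : ∀ k : ℕ, bracket q ^ k ≠ 0 := fun k => pow_ne_zero k hs
  rw [ZUU2, numeratorUU_eq hq hs h.x_ne h.y_ne, div_eq_iff (mul_ne_zero (hsn _) hbc),
    div_mul_eq_mul_div, mul_div_assoc', div_eq_iff hd]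
  refine mul_left_cancel₀ (mul_ne_zero (hsn n) (hsn (2 * n))) ?_
  rw [mul_pow, ← pow_mul] at e1
  generalize (∏ i, ∏ j, ((1 - scaledSq q (y j) - scaledSq q (x i)) ^ 2
          - tParam q * scaledSq q (y j) * scaledSq q (x i))) = D at *
  generalize (matrixUU q b c x y).det = M at *
  linear_combination bracket q ^ (2 * n) * bracket q ^ (4 * (n * n)) * D * e1
    - bracket q ^ n * bracket q ^ (n * (2 * n + 1)) * D * (interpUU q b c x y).det
      * (bracket (b / q) * bracket (c / q)) ^ n * e2

/-! ### The limit at the point where all variables are 1 -/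

lemma continuousAt_bracket {w : ℂ} (hw : w ≠ 0) : ContinuousAt bracket w :=
  continuousAt_id.sub (continuousAt_inv₀ hw)

lemma bracket_one : bracket 1 = 0 := by simp [bracket]

lemma tendsto_scaledSq (q : ℂ) :
    Tendsto (fun x : Fin n → ℂ => fun i => scaledSq q (x i)) (𝓝 fun _ => 1) (𝓝 0) := by
  refine tendsto_pi_nhds.2 fun i => ?_
  have h1 : Tendsto (fun x : Fin n → ℂ => x i) (𝓝 fun _ => 1) (𝓝 1) :=
    (continuous_apply i).tendsto (fun _ => (1 : ℂ))
  have h2 := (((continuousAt_bracket one_ne_zero).tendsto.comp h1).div_const (bracket q)).pow 2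
  simpa [bracket_one, scaledSq] using h2

lemma tendsto_scaledSq_pair (q : ℂ) :
    Tendsto (fun p : (Fin n → ℂ) × (Fin n → ℂ) =>
      ((fun i => scaledSq q (p.2 i), fun i => scaledSq q (p.1 i)) : (Fin n → ℂ) × (Fin n → ℂ)))
      (𝓝 (fun _ => 1, fun _ => 1)) (𝓝 (0, 0)) :=
  ((tendsto_scaledSq q).comp (continuous_snd.tendsto
    ((fun _ => 1, fun _ => 1) : (Fin n → ℂ) × (Fin n → ℂ)))).prodMk_nhds
    ((tendsto_scaledSq q).comp (continuous_fst.tendsto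
      ((fun _ => 1, fun _ => 1) : (Fin n → ℂ) × (Fin n → ℂ))))

lemma eventually_isRegular {q : ℂ} (hq : q ≠ 0) (hs : bracket q ≠ 0) :
    ∀ᶠ p : (Fin n → ℂ) × (Fin n → ℂ) in 𝓝 (fun _ => 1, fun _ => 1), IsRegular q p.1 p.2 := by
  have hx : ∀ i : Fin n, Tendsto (fun p : (Fin n → ℂ) × (Fin n → ℂ) => p.1 i)
      (𝓝 (fun _ => 1, fun _ => 1)) (𝓝 1) := fun i =>
    ((continuous_apply i).comp continuous_fst).tendsto
      ((fun _ => 1, fun _ => 1) : (Fin n → ℂ) × (Fin n → ℂ))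
  have hy : ∀ i : Fin n, Tendsto (fun p : (Fin n → ℂ) × (Fin n → ℂ) => p.2 i)
      (𝓝 (fun _ => 1, fun _ => 1)) (𝓝 1) := fun i =>
    ((continuous_apply i).comp continuous_snd).tendsto
      ((fun _ => 1, fun _ => 1) : (Fin n → ℂ) × (Fin n → ℂ))
  have hb : ∀ {f : (Fin n → ℂ) × (Fin n → ℂ) → ℂ},
      Tendsto f (𝓝 (fun _ => 1, fun _ => 1)) (𝓝 q) →
      ∀ᶠ p in 𝓝 (fun _ => 1, fun _ => 1), bracket (f p) ≠ 0 := fun hf =>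
    ((continuousAt_bracket hq).tendsto.comp hf).eventually_ne hs
  have hc : Tendsto (fun _ : (Fin n → ℂ) × (Fin n → ℂ) => q)
      (𝓝 (fun _ => 1, fun _ => 1)) (𝓝 q) := tendsto_const_nhds
  have e1 : ∀ᶠ p : (Fin n → ℂ) × (Fin n → ℂ) in 𝓝 (fun _ => 1, fun _ => 1), ∀ i, p.1 i ≠ 0 :=
    eventually_all.2 fun i => (hx i).eventually_ne one_ne_zero
  have e2 : ∀ᶠ p : (Fin n → ℂ) × (Fin n → ℂ) in 𝓝 (fun _ => 1, fun _ => 1), ∀ i, p.2 i ≠ 0 :=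
    eventually_all.2 fun i => (hy i).eventually_ne one_ne_zero
  have e3 := eventually_all.2 fun i => eventually_all.2 fun j =>
    hb (by simpa using (hc.mul (hx i)).div (hy j) one_ne_zero)
  have e4 := eventually_all.2 fun i => eventually_all.2 fun j =>
    hb (by simpa using (hc.mul (hy j)).div (hx i) one_ne_zero)
  have e5 := eventually_all.2 fun i => eventually_all.2 fun j =>
    hb (by simpa using (hc.mul (hx i)).mul (hy j))
  have e6 := eventually_all.2 fun i => eventually_all.2 fun j =>
    hb (by simpa using hc.div ((hx i).mul (hy j)) (by simp))
  have e7 := (tendsto_scaledSq_pair (n := n) q).eventually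
    (eventually_isUnit_det_quadOperator (tParam q))
  filter_upwards [e1, e2, e3, e4, e5, e6, e7] with p p1 p2 p3 p4 p5 p6 p7
  exact ⟨p1, p2, p3, p4, p5, p6, p7⟩

lemma tendsto_normalized_ZUU2 {q b c : ℂ} (hq : q ≠ 0) (hb : b ≠ 0) (hc : c ≠ 0)
    (hs : bracket q ≠ 0) (hbq : bracket (b / q) ≠ 0) (hcq : bracket (c / q) ≠ 0) :
    Tendsto (fun p : (Fin n → ℂ) × (Fin n → ℂ) =>
        bracket (q ^ 2) ^ (2 * n) * ZUU2 q b c p.1 p.2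
          / (bracket q ^ (n * (2 * n + 1)) * (bracket (b / q) * bracket (c / q)) ^ n))
      (𝓝[{p | denominatorUU p.1 p.2 ≠ 0}] (fun _ => 1, fun _ => 1))
      (𝓝 (coeffMatrix n (partialSeries (tParam q) (constCoeff q b c) (1 + boundaryParam q c)
        (1 + boundaryParam q b) n)).det) := by
  have hlim : Tendsto (fun p : (Fin n → ℂ) × (Fin n → ℂ) =>
      (∏ i, ∏ j, ((1 - scaledSq q (p.2 j) - scaledSq q (p.1 i)) ^ 2
          - tParam q * scaledSq q (p.2 j) * scaledSq q (p.1 i))) * (interpUU q b c p.1 p.2).det)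
      (𝓝 (fun _ => 1, fun _ => 1))
      (𝓝 (coeffMatrix n (partialSeries (tParam q) (constCoeff q b c) (1 + boundaryParam q c)
        (1 + boundaryParam q b) n)).det) := by
    have hK := (continuousAt_interpMatrix (n := n) (tParam q) (constCoeff q b c)
      (tParam q * (1 + boundaryParam q c)) (tParam q * (1 + boundaryParam q b))).tendsto.comp
        (tendsto_scaledSq_pair q)
    rw [interpMatrix_zero] at hK
    have hdet := (continuous_id.matrix_det.tendsto _).comp hK
    have hprod : Continuous fun p : (Fin n → ℂ) × (Fin n → ℂ) =>
        ∏ i, ∏ j, ((1 - p.1 j - p.2 i) ^ 2 - tParam q * p.1 j * p.2 i) := by fun_prop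
    have hprod' := (hprod.tendsto (0, 0)).comp (tendsto_scaledSq_pair (n := n) q)
    simpa [Function.comp_def, interpUU] using hprod'.mul hdet
  refine (hlim.mono_left nhdsWithin_le_nhds).congr' ?_
  filter_upwards [nhdsWithin_le_nhds (eventually_isRegular (n := n) hq hs), self_mem_nhdsWithin]
    with p hp hd
  exact (normalized_ZUU2_eq hq hb hc hs hbq hcq hp hd).symm

lemma eval_det_eq (v : Fin 3 → ℂ) : MvPolynomial.eval v (Matrix.det (Matrix.of fun i j : Fin n =>
        ∑ k ∈ Finset.range n,
          (((MvPolynomial.X 0 : MvPolynomial (Fin 3) ℂ)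
                + (1 + MvPolynomial.X 1) * (1 + MvPolynomial.X 2))
              * (Nat.choose (i + j) (i + k) : MvPolynomial (Fin 3) ℂ)
              * (Nat.choose (i + k) (2 * k) : MvPolynomial (Fin 3) ℂ) * MvPolynomial.X 0 ^ k
            + ((1 + MvPolynomial.X 2) * (Nat.choose (i + j) (i + k) : MvPolynomial (Fin 3) ℂ)
                  * (Nat.choose (i + k) (2 * k + 1) : MvPolynomial (Fin 3) ℂ)
                + (1 + MvPolynomial.X 1)
                  * (Nat.choose (i + j) (i + k + 1) : MvPolynomial (Fin 3) ℂ)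
                  * (Nat.choose (i + k + 1) (2 * k + 1) : MvPolynomial (Fin 3) ℂ))
              * MvPolynomial.X 0 ^ (k + 1))))
      = (coeffMatrix n (partialSeries (v 0) (v 0 + (1 + v 1) * (1 + v 2)) (1 + v 2) (1 + v 1)
          n)).det := by
  rw [RingHom.map_det]
  congr 1
  ext i j
  rw [coeffMatrix_partialSeries_apply]
  simp

/-! ### Uniqueness of the polynomial -/

lemma bracket_exp_ne_zero {r : ℝ} (hr : r ≠ 0) : bracket (Complex.exp r) ≠ 0 := by
  intro h
  rw [bracket, ← Complex.exp_neg, sub_eq_zero, ← Complex.ofReal_neg, ← Complex.ofReal_exp,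
    ← Complex.ofReal_exp, Complex.ofReal_inj, Real.exp_eq_exp] at h
  exact hr (by linarith)

/-- Without this, limits along the filter would not be unique. The witness is the curve `x_i = y_i =
exp (r (i + 1))`, `r → 0⁺`: its exponents are distinct and positive, so no bracket in the
denominator vanishes. -/
lemma neBot_nhdsWithin_denominatorUU :
    (𝓝[{p : (Fin n → ℂ) × (Fin n → ℂ) | denominatorUU p.1 p.2 ≠ 0}]
      (fun _ => 1, fun _ => 1)).NeBot := by
  let γ : ℝ → Fin n → ℂ := fun r i => Complex.exp ((r * ((i : ℕ) + 1) : ℝ) : ℂ)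
  have hγ : Continuous γ := by
    refine continuous_pi fun i => ?_
    simp only [γ]
    fun_prop
  have h0 : γ 0 = fun _ => 1 := by
    ext i
    simp [γ]
  have ht : Tendsto (fun r => (γ r, γ r)) (𝓝[>] 0)
      (𝓝[{p : (Fin n → ℂ) × (Fin n → ℂ) | denominatorUU p.1 p.2 ≠ 0}]
        (fun _ => 1, fun _ => 1)) := by
    refine tendsto_nhdsWithin_iff.2 ⟨?_, ?_⟩
    · have := (hγ.prodMk hγ).tendsto 0
      rw [h0] at this
      exact this.mono_left nhdsWithin_le_nhds
    · filter_upwards [self_mem_nhdsWithin] with r hr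
      have hr : 0 < r := hr
      have hdiv : ∀ {i j : Fin n}, i ≠ j → bracket (γ r i / γ r j) ≠ 0 := fun {i j} hij => by
        simp only [γ]
        rw [← Complex.exp_sub, ← Complex.ofReal_sub]
        refine bracket_exp_ne_zero ?_
        rw [← mul_sub]
        refine mul_ne_zero hr.ne' ?_
        rw [add_sub_add_right_eq_sub, sub_ne_zero]
        exact fun h => hij (Fin.ext (by exact_mod_cast h))
      have hmul : ∀ i j : Fin n, bracket (γ r i * γ r j) ≠ 0 := fun i j => by
        simp only [γ]
        rw [← Complex.exp_add, ← Complex.ofReal_add]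
        exact bracket_exp_ne_zero (by positivity)
      refine mul_ne_zero ?_ ?_
      · refine Finset.prod_ne_zero_iff.2 fun i _ => Finset.prod_ne_zero_iff.2 fun j hj => ?_
        have hij : i ≠ j := (Finset.mem_Ioi.1 hj).ne
        exact mul_ne_zero (hdiv hij.symm) (hdiv hij)
      · refine Finset.prod_ne_zero_iff.2 fun i _ => Finset.prod_ne_zero_iff.2 fun j _ => ?_
        refine mul_ne_zero ?_ (hmul i j)
        rw [one_div, bracket_inv]
        exact neg_ne_zero.2 (hmul i j)
  exact ht.neBot

/-- Every value other than `q ^ 2`, `q ^ (-2)` is taken by the boundary parameter. -/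
lemma exists_boundaryParam_eq {q y : ℂ} (hq : q ≠ 0) (hq4 : q ^ 4 ≠ 1) (h1 : y ≠ q ^ 2)
    (h2 : y * q ^ 2 ≠ 1) : ∃ b : ℂ, b ≠ 0 ∧ bracket (b / q) ≠ 0 ∧ boundaryParam q b = y := by
  have h1' : y - q ^ 2 ≠ 0 := sub_ne_zero.2 h1
  have h2' : y * q ^ 2 - 1 ≠ 0 := sub_ne_zero.2 h2
  -- Clearing denominators in `[bq] = y [b/q]` gives a linear equation for `b ^ 2`.
  obtain ⟨b, hb⟩ : ∃ b : ℂ, b ^ 2 = (y * q ^ 2 - 1) / (y - q ^ 2) :=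
    IsAlgClosed.exists_pow_nat_eq _ two_pos
  have hb0 : b ≠ 0 := by
    rintro rfl
    rw [zero_pow two_ne_zero] at hb
    exact div_ne_zero h2' h1' hb.symm
  rw [eq_div_iff h1'] at hb
  have hbq : bracket (b / q) ≠ 0 := by
    intro h
    have hbq2 : b ^ 2 = q ^ 2 := by
      simp only [bracket] at h
      field_simp at h
      linear_combination h
    rw [hbq2] at hb
    exact hq4 (by linear_combination -hb)
  refine ⟨b, hb0, hbq, ?_⟩
  rw [boundaryParam, div_eq_iff hbq]
  simp only [bracket]
  field_simp
  linear_combination -hb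

/-- A polynomial is determined by its values at the parameters `t, y, z` of all `q, b, c`. -/
lemma eq_of_eval_eq {P Q : MvPolynomial (Fin 3) ℂ}
    (h : ∀ q b c : ℂ, q ≠ 0 → b ≠ 0 → c ≠ 0 → bracket q ≠ 0 → bracket (b / q) ≠ 0 →
      bracket (c / q) ≠ 0 →
      MvPolynomial.eval ![tParam q, boundaryParam q b, boundaryParam q c] P
        = MvPolynomial.eval ![tParam q, boundaryParam q b, boundaryParam q c] Q) : P = Q := by
  -- The choice `q = m + 2` gives infinitely many `t`. For each of them every negative integer is an
  -- admissible `y` or `z`, as it differs from the positive numbers `q ^ 2` and `q ^ (-2)`. The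
  -- values therefore fill a product of infinite sets.
  let T : Set ℂ := Set.range fun m : ℕ => tParam (m + 2)
  let Y : Set ℂ := Set.range fun m : ℕ => -((m : ℂ) + 1)
  have hY : Y.Infinite := Set.infinite_range_of_injective fun a b hab => by simpa using hab
  have hq0 : ∀ m : ℕ, ((m : ℂ) + 2) ≠ 0 := fun m => by exact_mod_cast (show m + 2 ≠ 0 by omega)
  have hs0 : ∀ m : ℕ, bracket ((m : ℂ) + 2) ≠ 0 := fun m hm => by
    have := hq0 m
    simp only [bracket] at hm
    have h1 : ((m : ℂ) + 2) ^ 2 = 1 := by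
      linear_combination ((m : ℂ) + 2) * hm + mul_inv_cancel₀ this
    have h2 : (m + 2) ^ 2 = 1 := by exact_mod_cast h1
    exact (Nat.one_lt_pow two_ne_zero (show 1 < m + 2 by omega)).ne' h2
  have hT : T.Infinite := Set.infinite_range_of_injective fun a b hab => by
    have e : ∀ m : ℕ, tParam ((m : ℂ) + 2) = (((m : ℂ) + 2) + ((m : ℂ) + 2)⁻¹) ^ 2 := fun m => by
      rw [tParam, bracket_sq _ (hq0 m), mul_div_cancel_left₀ _ (hs0 m)]
    simp only [e] at hab
    have hab' : (((a : ℝ) + 2) + ((a : ℝ) + 2)⁻¹) ^ 2 = (((b : ℝ) + 2) + ((b : ℝ) + 2)⁻¹) ^ 2 := by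
      apply Complex.ofReal_injective
      push_cast
      exact hab
    rw [pow_left_inj₀ (by positivity) (by positivity) two_ne_zero] at hab'
    have hpa : (0 : ℝ) < a + 2 := by positivity
    have hpb : (0 : ℝ) < b + 2 := by positivity
    field_simp at hab'
    -- The equation `s + 1/s = s' + 1/s'` factors as `(s - s')(s s' - 1) = 0`, and `s s' ≥ 4` here.
    have hf : ((a : ℝ) - b) * (((a : ℝ) + 2) * (b + 2) - 1) = 0 := by linear_combination hab'
    rcases mul_eq_zero.1 hf with h | h
    · exact_mod_cast sub_eq_zero.1 h
    · have h1 : (0 : ℝ) ≤ a := by positivity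
      have h2 : (0 : ℝ) ≤ b := by positivity
      nlinarith
  refine MvPolynomial.funext_set ![T, Y, Y] (fun i => ?_) fun v hv => ?_
  · fin_cases i <;> assumption
  · obtain ⟨m, hm⟩ : v 0 ∈ T := hv 0 (Set.mem_univ _)
    obtain ⟨k, hk⟩ : v 1 ∈ Y := hv 1 (Set.mem_univ _)
    obtain ⟨l, hl⟩ : v 2 ∈ Y := hv 2 (Set.mem_univ _)
    have hq4 : ((m : ℂ) + 2) ^ 4 ≠ 1 := by
      have : (m + 2) ^ 4 ≠ 1 := (Nat.one_lt_pow (by omega) (by omega)).ne'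
      exact_mod_cast this
    have h1 : ∀ k : ℕ, -((k : ℂ) + 1) ≠ ((m : ℂ) + 2) ^ 2 := fun k hk => by
      have h : ((k + 1 + (m + 2) ^ 2 : ℕ) : ℂ) = 0 := by push_cast; linear_combination -hk
      rw [Nat.cast_eq_zero] at h
      omega
    have h2 : ∀ k : ℕ, -((k : ℂ) + 1) * ((m : ℂ) + 2) ^ 2 ≠ 1 := fun k hk => by
      have h : ((1 + (k + 1) * (m + 2) ^ 2 : ℕ) : ℂ) = 0 := by push_cast; linear_combination -hk
      rw [Nat.cast_eq_zero] at h
      omega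
    obtain ⟨b, hb, hbq, hby⟩ := exists_boundaryParam_eq (hq0 m) hq4 (h1 k) (h2 k)
    obtain ⟨c, hc, hcq, hcz⟩ := exists_boundaryParam_eq (hq0 m) hq4 (h1 l) (h2 l)
    have hv' : v = ![tParam (m + 2), boundaryParam (m + 2) b, boundaryParam (m + 2) c] := by
      ext i
      fin_cases i
      · exact hm.symm
      · exact (hby.trans hk).symm
      · exact (hcz.trans hl).symm
    rw [hv']
    exact h _ b c (hq0 m) hb hc (hs0 m) hbq hcq

end KuperbergUU
end

open KuperbergUU

theorem mainTheorem7 (n : ℕ) (P : MvPolynomial (Fin 3) ℂ) (t y z : MvPolynomial (Fin 3) ℂ)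
    (ht : t = MvPolynomial.X 0) (hy : y = MvPolynomial.X 1) (hz : z = MvPolynomial.X 2) :
    KuperbergUU.IsAUU2 n P ↔
      P = Matrix.det (Matrix.of fun i j : Fin n =>
        ∑ k ∈ Finset.range n,
          ((t + (1 + y) * (1 + z))
              * (Nat.choose (i + j) (i + k) : MvPolynomial (Fin 3) ℂ)
              * (Nat.choose (i + k) (2 * k) : MvPolynomial (Fin 3) ℂ) * t ^ k
            + ((1 + z) * (Nat.choose (i + j) (i + k) : MvPolynomial (Fin 3) ℂ)
                  * (Nat.choose (i + k) (2 * k + 1) : MvPolynomial (Fin 3) ℂ)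
                + (1 + y) * (Nat.choose (i + j) (i + k + 1) : MvPolynomial (Fin 3) ℂ)
                  * (Nat.choose (i + k + 1) (2 * k + 1) : MvPolynomial (Fin 3) ℂ))
              * t ^ (k + 1))) := by
  subst ht hy hz
  have hlim : ∀ {q b c : ℂ}, q ≠ 0 → b ≠ 0 → c ≠ 0 → bracket q ≠ 0 → bracket (b / q) ≠ 0 →
      bracket (c / q) ≠ 0 → _ := fun hq hb hc hs hbq hcq =>
    tendsto_normalized_ZUU2 (n := n) hq hb hc hs hbq hcq
  have heval : ∀ q b c : ℂ, _ := fun q b c =>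
    eval_det_eq (n := n) ![tParam q, boundaryParam q b, boundaryParam q c]
  constructor
  · intro h
    refine eq_of_eval_eq fun q b c hq hb hc hs hbq hcq => ?_
    have := neBot_nhdsWithin_denominatorUU (n := n)
    rw [heval]
    exact tendsto_nhds_unique (h q b c hq hb hc hs hbq hcq) (hlim hq hb hc hs hbq hcq)
  · rintro rfl q b c hq hb hc hs hbq hcq
    rw [heval]
    exact hlim hq hb hc hs hbq hcq
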